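/- Let $M$ be a Markov chain on a finite state set $Q$, given by an initial distribution $\pi$ on $Q$ and transition probabilities $p(q,\cdot)$, each a probability distribution on $Q$. Assume that $M$ is connected: every state can be reached from every state along transitions of positive probability. Let $s:\mathbb{N}\to\mathbb{N}$ be an arbitrary function (the offset function). Let $(X_i)_{i\ge 1}$ be a sequence of $Q$-valued random variables on a probability space that is $\mathrm{Markov}(M)$: $X_1$ has distribution $\pi$, and conditionally on any history $X_1=x_1,\dots,X_n=x_n$ of positive probability, $X_{n+1}$ has distribution $p(x_n,\cdot)$. For $q\in Q$ and $n,k\in\mathbb{N}$ let $$V_q^n(k)=\sum_{i=1}^{k}\mathbf 1_{\{X_{s(n)+i}=q\}}$$ be the number of visits to $q$ within the first $k$ steps of the $n$-th suffix $X_{s(n)+1}X_{s(n)+2}\cdots$. Let $f_q=1/m_q$, where $m_q=\mathbb{E}_q\big[\inf\{k\ge 1: Y_k=q\}\big]$ is the expected return time to $q$ of a chain $(Y_k)_{k\ge 0}$ with transition probabilities $p$ and $Y_0=q$. Then for every state $q$, $$\frac{V_q^n(n)}{n}\xrightarrow{\text{a.s.}} f_q\qquad\text{as } n\to\infty .$$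 -/

import Mathlib

open MeasureTheory ProbabilityTheory Filter Topology
open scoped ENNReal

/-- A (time-homogeneous) Markov chain on the state space `Q`: an initial distribution and, for
every state, a probability distribution on the successor states. -/
structure MarkovChain (Q : Type*) where
  /-- The initial distribution. -/
  initial : PMF Q
  /-- `trans q q'` is the probability of moving from `q` to `q'` in one step. -/
  trans : Q → PMF Q

namespace MarkovChain

/-- The chain is connected: every state can be reached from every state along transitions of
positive probability (the transition graph is strongly connected). -/
def Connected {Q : Type*} (M : MarkovChain Q) : Prop :=
  ∀ q q' : Q, Relation.ReflTransGen (fun a b => M.trans a b ≠ 0) q q'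

/-- The sequence `X 1, X 2, …` of `Q`-valued random variables on `(Ω, μ)` is `Markov(M)`: `X 1` is
distributed according to the initial distribution of `M`, and conditionally on any history
`X 1 = x 1, …, X n = x n` of positive probability, `X (n + 1)` is distributed according to the
transition distribution of `M` at `x n`. The sequence starts at index `1`; `X 0` plays no role. -/
structure IsMarkov {Q : Type*} [MeasurableSpace Q] (M : MarkovChain Q)
    {Ω : Type*} [MeasurableSpace Ω] (X : ℕ → Ω → Q) (μ : Measure Ω) : Prop where
  measurable : ∀ n, 1 ≤ n → Measurable (X n)
  initial : ∀ q : Q, μ {ω | X 1 ω = q} = M.initial q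
  step : ∀ n, 1 ≤ n → ∀ (x : ℕ → Q) (q : Q),
    μ {ω | ∀ i, 1 ≤ i → i ≤ n → X i ω = x i} ≠ 0 →
      μ[|{ω | ∀ i, 1 ≤ i → i ≤ n → X i ω = x i}] {ω | X (n + 1) ω = q} = M.trans (x n) q

section PathSpace

variable {Q : Type*} [Countable Q] [MeasurableSpace Q] [DiscreteMeasurableSpace Q]

/-- The transition probabilities of `M` as a kernel from states to states. -/
noncomputable def kernel (M : MarkovChain Q) : Kernel Q Q :=
  Kernel.ofFunOfCountable fun q => (M.trans q).toMeasure

instance (M : MarkovChain Q) : IsMarkovKernel M.kernel :=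
  ⟨fun q => PMF.toMeasure.isProbabilityMeasure (M.trans q)⟩

/-- The transition probabilities of `M` at time `n`, as a kernel from histories `x 0, …, x n` to
states; it depends on the last state `x n` only. -/
noncomputable def historyKernel (M : MarkovChain Q) (n : ℕ) :
    Kernel ((i : Finset.Iic n) → (fun _ : ℕ => Q) i) Q :=
  M.kernel.comap (fun x => x ⟨n, Finset.mem_Iic.2 le_rfl⟩) (measurable_pi_apply _)

instance (M : MarkovChain Q) (n : ℕ) : IsMarkovKernel (M.historyKernel n) := by
  unfold historyKernel; infer_instance

/-- The law, on the space of infinite paths `x 0, x 1, …`, of the chain with the transition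
probabilities of `M` started in the state `q` at time `0`. -/
noncomputable def pathMeasure (M : MarkovChain Q) (q : Q) : Measure (ℕ → Q) :=
  Kernel.trajMeasure (X := fun _ : ℕ => Q) (PMF.pure q).toMeasure M.historyKernel

end PathSpace

/-- The time of the first visit to `q` at a time `n ≥ 1` along the path `x`, infinite if there is
no such visit. For a path that starts in `q` at time `0` this is the return time to `q`. -/
noncomputable def returnTime {Q : Type*} (q : Q) (x : ℕ → Q) : ℕ∞ :=
  ⨅ (n : ℕ) (_ : 1 ≤ n ∧ x n = q), (n : ℕ∞)

/-- The expected return time to `q` of the chain started in `q`. -/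
noncomputable def expectedReturnTime {Q : Type*} [Countable Q] [MeasurableSpace Q]
    [DiscreteMeasurableSpace Q] (M : MarkovChain Q) (q : Q) : ℝ≥0∞ :=
  ∫⁻ x, (returnTime q x : ℝ≥0∞) ∂(M.pathMeasure q)

/-- The frequency `f_q` of the state `q`: the inverse of the expected return time to `q`. (The
expected return time is at least `1`, and the frequency is `0` if it is infinite.) -/
noncomputable def frequency {Q : Type*} [Countable Q] [MeasurableSpace Q]
    [DiscreteMeasurableSpace Q] (M : MarkovChain Q) (q : Q) : ℝ :=
  (M.expectedReturnTime q)⁻¹.toReal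

end MarkovChain

open Classical in
/-- `visits s X q n k ω` is the number of visits of the sequence `X 1, X 2, …` to the state `q`
within the first `k` steps of its `n`-th suffix `X (s n + 1), X (s n + 2), …`. -/
noncomputable def visits {Q Ω : Type*} (s : ℕ → ℕ) (X : ℕ → Ω → Q) (q : Q) (n k : ℕ) (ω : Ω) : ℕ :=
  ∑ i ∈ Finset.Icc 1 k, if X (s n + i) ω = q then 1 else 0

/-! The offset `s` is arbitrary, so an ergodic theorem for a single trajectory does not suffice.
What is needed is a tail bound for a window of length `n` that is uniform in its starting point and
summable in `n`.

Let `h` be the expected hitting time of `q`, set to `0` at `q` (`potential`), and let `H` be the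
expected return time. First-step analysis gives the Poisson equation `P h = h - 1 + H * 1_q`. Summed
over a window of length `k`, it telescopes (`Connected.visits_mul_hittingTime`) to `V * H = k - D +
boundary`, where `D` is a sum of martingale differences of `h`. Connectedness and finiteness of `Q`
make `h` finite and bounded by some `B`, so the boundary term is at most `B` in absolute value. The
Azuma-Hoeffding argument makes `D` sub-Gaussian with proxy `k * (B / 2) ^ 2`, whatever the offset.
Chernoff and Borel-Cantelli then give `D / n → 0` almost surely for `k = n`, without any
independence between windows. -/

namespace MarkovChain

/-- The history `Y 0, …, Y n` of a process. -/
def history {Q Ω : Type*} (Y : ℕ → Ω → Q) (n : ℕ) (ω : Ω) : (i : Finset.Iic n) → (fun _ : ℕ => Q) i :=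
  fun i => Y i ω

theorem measurable_history {Q Ω : Type*} [MeasurableSpace Q] [MeasurableSpace Ω]
    {Y : ℕ → Ω → Q} (hY : ∀ n, Measurable (Y n)) (n : ℕ) :
    Measurable (history Y n) :=
  measurable_pi_lambda _ fun i => hY i

/-! ### The Markov property as an identity of joint laws -/

section Transitions

variable {Q : Type*} [Finite Q] [MeasurableSpace Q] [DiscreteMeasurableSpace Q]
  {Ω : Type*} [MeasurableSpace Ω]

/-- The process `Y 0, Y 1, …` moves according to the transition probabilities of `M`: the joint law
of a history and the next state is the composition of the law of the history with the
transition kernel. -/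
structure HasTransitions (M : MarkovChain Q) (Y : ℕ → Ω → Q) (μ : Measure Ω) : Prop where
  measurable : ∀ n, Measurable (Y n)
  map_history_compProd : ∀ n, μ.map (history Y n) ⊗ₘ M.historyKernel n =
    μ.map (fun ω => (history Y n ω, Y (n + 1) ω))

theorem kernel_singleton (M : MarkovChain Q) (q q' : Q) : M.kernel q {q'} = M.trans q q' :=
  PMF.toMeasure_apply_singleton _ _ (measurableSet_singleton _)

theorem historyKernel_apply (M : MarkovChain Q) (n : ℕ)
    (h : (i : Finset.Iic n) → (fun _ : ℕ => Q) i) :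
    M.historyKernel n h = M.kernel (h ⟨n, Finset.mem_Iic.2 le_rfl⟩) := rfl

/-- Histories range over a finite space, so comparing singletons is enough; null histories give `0`
on both sides. -/
theorem IsMarkov.hasTransitions {M : MarkovChain Q} {X : ℕ → Ω → Q} {μ : Measure Ω}
    [IsProbabilityMeasure μ] (hX : M.IsMarkov X μ) :
    M.HasTransitions (fun n => X (n + 1)) μ := by
  have hm : ∀ n, Measurable (X (n + 1)) := fun n => hX.measurable _ (by omega)
  refine ⟨hm, fun n => Measure.ext_of_singleton ?_⟩
  rintro ⟨h, q⟩
  have hH := measurable_history hm n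
  rw [← Set.singleton_prod_singleton,
    Measure.compProd_apply_prod (measurableSet_singleton _) (measurableSet_singleton _),
    lintegral_singleton, historyKernel_apply, kernel_singleton,
    Measure.map_apply hH (measurableSet_singleton _),
    Measure.map_apply (hH.prodMk (hm _)) ((measurableSet_singleton _).prod
      (measurableSet_singleton _))]
  -- The history `h`, shifted to start at time `1`; values outside `1, …, n + 1` are never used.
  let x : ℕ → Q := fun i => if hi : i - 1 ≤ n then h ⟨i - 1, Finset.mem_Iic.2 hi⟩ else q
  have hx : history (fun n => X (n + 1)) n ⁻¹' {h} =
      {ω | ∀ i, 1 ≤ i → i ≤ n + 1 → X i ω = x i} := by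
    ext ω
    simp only [Set.mem_preimage, Set.mem_singleton_iff, Set.mem_ofPred_eq]
    constructor
    · rintro rfl i h1 h2
      have : i - 1 ≤ n := by omega
      simp only [x, this, dif_pos, history]
      congr 1
      omega
    · intro H
      funext ⟨i, hi⟩
      have hi' := Finset.mem_Iic.1 hi
      have := H (i + 1) (by omega) (by omega)
      simpa [x, hi', history] using this
  have hprod : (fun ω => (history (fun n => X (n + 1)) n ω, X (n + 1 + 1) ω)) ⁻¹' ({h} ×ˢ {q}) =
      (history (fun n => X (n + 1)) n ⁻¹' {h}) ∩ {ω | X (n + 1 + 1) ω = q} := by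
    ext ω; simp
  have hxn : x (n + 1) = h ⟨n, Finset.mem_Iic.2 le_rfl⟩ := by simp [x]
  rw [hprod]
  by_cases h0 : μ (history (fun n => X (n + 1)) n ⁻¹' {h}) = 0
  · rw [h0, mul_zero, measure_mono_null Set.inter_subset_left h0]
  · have hstep := hX.step (n + 1) (by omega) x q (by rwa [← hx])
    rw [← hx, cond_apply (hH (measurableSet_singleton _)), hxn] at hstep
    rw [← hstep, mul_comm, ← mul_assoc, ENNReal.mul_inv_cancel h0 (measure_ne_top _ _), one_mul]

theorem pathMeasure_hasTransitions (M : MarkovChain Q) (q : Q) :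
    M.HasTransitions (fun n (x : ℕ → Q) => x n) (M.pathMeasure q) := by
  have : IsProbabilityMeasure (PMF.pure q).toMeasure := inferInstance
  exact ⟨fun n => measurable_pi_apply n, fun n =>
    Kernel.map_frestrictLe_trajMeasure_compProd_eq_map_trajMeasure (X := fun _ : ℕ => Q)
      (μ₀ := (PMF.pure q).toMeasure) (κ := M.historyKernel) (a := n)⟩

instance (M : MarkovChain Q) (q : Q) : IsProbabilityMeasure (M.pathMeasure q) := by
  have : IsProbabilityMeasure (PMF.pure q).toMeasure := inferInstance
  exact inferInstanceAs (IsProbabilityMeasure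
    (Kernel.trajMeasure (X := fun _ : ℕ => Q) (PMF.pure q).toMeasure M.historyKernel))

theorem pathMeasure_initial (M : MarkovChain Q) (q : Q) :
    ∀ᵐ x ∂(M.pathMeasure q), x 0 = q := by
  have key : (M.pathMeasure q).map (Preorder.frestrictLe (π := fun _ : ℕ => Q) 0) =
      (PMF.pure q).toMeasure.map
        (MeasurableEquiv.piUnique (fun _ : Finset.Iic 0 => Q)).symm := by
    rw [pathMeasure, Kernel.trajMeasure, Measure.map_comp _ _ (by fun_prop),
      Kernel.traj_map_frestrictLe, Kernel.partialTraj_self, Measure.id_comp]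
  have h0 : ∀ᵐ h ∂((M.pathMeasure q).map (Preorder.frestrictLe (π := fun _ : ℕ => Q) 0)),
      h ⟨0, Finset.mem_Iic.2 le_rfl⟩ = q := by
    rw [key, ae_map_iff (by fun_prop) (MeasurableSet.of_discrete)]
    rw [PMF.toMeasure_pure, ae_dirac_iff (MeasurableSet.of_discrete)]
    rfl
  exact (ae_map_iff (by fun_prop) (MeasurableSet.of_discrete)).1 h0

end Transitions

end MarkovChain

namespace MarkovChain

/-! ### Azuma-Hoeffding for the deviations -/

section Concentration

variable {Q : Type*} [Finite Q] [MeasurableSpace Q] [DiscreteMeasurableSpace Q]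
  {Ω : Type*} [MeasurableSpace Ω]

/-- The sum of the deviations of `g` from its conditional expectation over the `k` transitions that
start at the times `a, …, a + k - 1`. -/
noncomputable def deviation (M : MarkovChain Q) (g : Q → ℝ) (Y : ℕ → Ω → Q) (a k : ℕ) (ω : Ω) : ℝ :=
  ∑ i ∈ Finset.range k, (g (Y (a + i + 1) ω) - ∫ y, g y ∂M.kernel (Y (a + i) ω))

/-- Given the history up to time `a + k`, the next increment is a centred variable in an interval of
length `B`. Hoeffding's lemma bounds its conditional moment generating function, and induction on
`k` multiplies the bounds. The proxy does not depend on `a`. -/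
theorem HasTransitions.hasSubgaussianMGF_deviation {M : MarkovChain Q} {Y : ℕ → Ω → Q}
    {μ : Measure Ω} [IsProbabilityMeasure μ] (hY : M.HasTransitions Y μ) {g : Q → ℝ} {B : ℝ}
    (hg : ∀ q, g q ∈ Set.Icc 0 B) (a k : ℕ) :
    HasSubgaussianMGF (M.deviation g Y a k) (k * (‖B‖₊ / 2) ^ 2) μ := by
  -- Factoring through the history moves every integral to a finite space, where integrability is
  -- automatic.
  have hdev : ∀ k, ∃ f : ((i : Finset.Iic (a + k)) → (fun _ : ℕ => Q) i) → ℝ,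
      ∀ ω, M.deviation g Y a k ω = f (history Y (a + k) ω) := fun k =>
    ⟨fun h => ∑ i ∈ (Finset.range k).attach,
      (g (h ⟨a + i + 1, Finset.mem_Iic.2 (by have := Finset.mem_range.1 i.2; omega)⟩) -
        ∫ y, g y ∂M.kernel (h ⟨a + i,
          Finset.mem_Iic.2 (by have := Finset.mem_range.1 i.2; omega)⟩)),
      fun ω => (Finset.sum_attach (Finset.range k) (fun i =>
        g (Y (a + i + 1) ω) - ∫ y, g y ∂M.kernel (Y (a + i) ω))).symm⟩
  have hH := measurable_history hY.measurable
  have hfin : ∀ n (f : ((i : Finset.Iic n) → (fun _ : ℕ => Q) i) → ℝ),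
      Integrable (fun ω => f (history Y n ω)) μ := fun n f => by
    have := Measure.isProbabilityMeasure_map (μ := μ) (hH n).aemeasurable
    exact (Integrable.of_finite (f := f) (μ := μ.map (history Y n))).comp_measurable (hH n)
  refine ⟨fun t => ?_, fun t => ?_⟩
  · obtain ⟨f, hf⟩ := hdev k
    simp only [hf]
    exact hfin _ fun h => Real.exp (t * f h)
  · induction k with
    | zero => simp [mgf, deviation]
    | succ k ih =>
      obtain ⟨f, hf⟩ := hdev k
      set c : NNReal := (‖B‖₊ / 2) ^ 2 with hc
      have := Measure.isProbabilityMeasure_map (μ := μ) (hH (a + k)).aemeasurable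
      let l : ((i : Finset.Iic (a + k)) → (fun _ : ℕ => Q) i) → Q :=
        fun h => h ⟨a + k, Finset.mem_Iic.2 le_rfl⟩
      have hstep : ∀ x, ∫ y, Real.exp (t * (g y - ∫ z, g z ∂M.kernel x)) ∂M.kernel x ≤
          Real.exp (c * t ^ 2 / 2) := fun x => by
        have := (hasSubgaussianMGF_of_mem_Icc (μ := M.kernel x) (X := g)
          (Measurable.of_discrete).aemeasurable (ae_of_all _ hg)).mgf_le t
        simpa [mgf, hc] using this
      calc mgf (M.deviation g Y a (k + 1)) μ t
          = ∫ ω, (fun p : ((i : Finset.Iic (a + k)) → (fun _ : ℕ => Q) i) × Q =>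
              Real.exp (t * f p.1) *
                Real.exp (t * (g p.2 - ∫ z, g z ∂M.kernel (l p.1))))
                (history Y (a + k) ω, Y (a + k + 1) ω) ∂μ := by
            refine integral_congr_ae (ae_of_all _ fun ω => ?_)
            simp only [← Real.exp_add, ← mul_add, ← hf, deviation, Finset.sum_range_succ]
            rfl
        _ = ∫ p, Real.exp (t * f p.1) * Real.exp (t * (g p.2 - ∫ z, g z ∂M.kernel (l p.1)))
              ∂(μ.map (history Y (a + k)) ⊗ₘ M.historyKernel (a + k)) := by
            rw [hY.map_history_compProd, integral_map
              ((hH _).prodMk (hY.measurable _)).aemeasurable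
              (Measurable.of_discrete).aestronglyMeasurable]
        _ = ∫ h, Real.exp (t * f h) *
              ∫ y, Real.exp (t * (g y - ∫ z, g z ∂M.kernel (l h))) ∂M.kernel (l h)
              ∂(μ.map (history Y (a + k))) := by
            rw [Measure.integral_compProd Integrable.of_finite]
            simp only [integral_const_mul, historyKernel_apply]
            rfl
        _ ≤ ∫ h, Real.exp (t * f h) * Real.exp (c * t ^ 2 / 2) ∂(μ.map (history Y (a + k))) := by
            refine integral_mono Integrable.of_finite Integrable.of_finite fun h => ?_
            exact mul_le_mul_of_nonneg_left (hstep _) (Real.exp_pos _).le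
        _ = mgf (M.deviation g Y a k) μ t * Real.exp (c * t ^ 2 / 2) := by
            rw [integral_mul_const, integral_map (hH _).aemeasurable
              (Measurable.of_discrete).aestronglyMeasurable]
            simp only [mgf, hf]
        _ ≤ Real.exp (↑(k * c) * t ^ 2 / 2) * Real.exp (c * t ^ 2 / 2) :=
            mul_le_mul_of_nonneg_right ih (Real.exp_pos _).le
        _ = Real.exp (↑(↑(k + 1) * c) * t ^ 2 / 2) := by
            rw [← Real.exp_add]; push_cast; ring_nf

end Concentration

end MarkovChain

/-- A sequence whose `n`-th term is sub-Gaussian with variance proxy `n * c` is almost surely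
`o(n)`. -/
theorem ProbabilityTheory.HasSubgaussianMGF.tendsto_div_atTop_zero {Ω : Type*} [MeasurableSpace Ω]
    {μ : Measure Ω} [IsProbabilityMeasure μ] {Z : ℕ → Ω → ℝ} {c : NNReal}
    (hZ : ∀ n : ℕ, HasSubgaussianMGF (Z n) (n * c) μ) :
    ∀ᵐ ω ∂μ, Tendsto (fun n : ℕ => Z n ω / n) atTop (𝓝 0) := by
  -- Enlarging `c` to `c + 1` keeps the Chernoff exponent `-n * ε ^ 2 / (2 * (c + 1))` meaningful
  -- when `c = 0`; the tails are then dominated by a geometric series.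
  have key : ∀ (W : ℕ → Ω → ℝ), (∀ n : ℕ, HasSubgaussianMGF (W n) (n * (c + 1)) μ) →
      ∀ m : ℕ, ∀ᵐ ω ∂μ, ∀ᶠ n : ℕ in atTop, W n ω < n * (1 / (m + 1 : ℝ)) := by
    intro W hW m
    set ε : ℝ := 1 / (m + 1) with hε
    have hε0 : 0 < ε := by positivity
    have hsum : Summable fun n : ℕ => μ.real {ω | n * ε ≤ W n ω} := by
      refine Summable.of_nonneg_of_le (fun _ => measureReal_nonneg) (fun n => ?_)
        (Real.summable_exp_nat_mul_of_ge (c := -ε ^ 2 / (2 * (c + 1)))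
          (div_neg_of_neg_of_pos (by simpa using pow_pos hε0 2) (by positivity))
          (f := fun n => (n : ℝ)) fun n => le_rfl)
      refine ((hW n).measure_ge_le (by positivity)).trans (Real.exp_le_exp.2 (le_of_eq ?_))
      rcases eq_or_ne n 0 with rfl | hn
      · simp
      · have : (n : ℝ) ≠ 0 := by exact_mod_cast hn
        push_cast
        field_simp
    have := ae_eventually_notMem (μ := μ) (s := fun n : ℕ => {ω | n * ε ≤ W n ω}) (by
      have h := hsum.tsum_ofReal_ne_top
      simpa [ofReal_measureReal] using h)
    filter_upwards [this] with ω hω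
    filter_upwards [hω] with n hn
    simpa using hn
  have hmono : ∀ n : ℕ, HasSubgaussianMGF (Z n) (n * (c + 1)) μ := fun n =>
    ⟨(hZ n).integrable_exp_mul, fun t => ((hZ n).mgf_le t).trans (Real.exp_le_exp.2 (by
      push_cast; gcongr; linarith))⟩
  have h1 := ae_all_iff.2 (key Z hmono)
  have h2 := ae_all_iff.2 (key (fun n => -Z n) fun n => (hmono n).neg)
  filter_upwards [h1, h2] with ω h1 h2
  -- This form quantifies over `n > N`, which makes `n` positive.
  rw [Metric.tendsto_atTop']
  intro ε hε
  obtain ⟨m, hm⟩ := exists_nat_one_div_lt hε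
  obtain ⟨N, hN⟩ := eventually_atTop.1 ((h1 m).and (h2 m))
  refine ⟨N, fun n hn => ?_⟩
  have hn0 : (0 : ℝ) < n := by exact_mod_cast (by omega : 0 < n)
  obtain ⟨h3, h4⟩ := hN n hn.le
  rw [Real.dist_eq, sub_zero, abs_div, abs_of_pos hn0, div_lt_iff₀ hn0, abs_lt]
  simp only [Pi.neg_apply] at h4
  constructor <;> nlinarith

/-! ### Hitting times: tail sums, first-step analysis and finiteness -/

theorem ENat.toENNReal_eq_tsum (T : ℕ∞) :
    (T : ℝ≥0∞) = ∑' n : ℕ, if (n : ℕ∞) < T then 1 else 0 := by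
  induction T using ENat.recTopCoe with
  | top => simp
  | coe k =>
    rw [tsum_eq_sum (s := Finset.range k) (by simp)]
    simp [Finset.filter_true_of_mem]

namespace MarkovChain

theorem measurableSet_forall_ne {Q Ω : Type*} [MeasurableSpace Q] [MeasurableSingletonClass Q]
    [MeasurableSpace Ω] {Y : ℕ → Ω → Q} (hY : ∀ n, Measurable (Y n)) (q : Q) (m : ℕ) :
    MeasurableSet {ω | ∀ i, 1 ≤ i → i ≤ m → Y i ω ≠ q} := by
  simp only [Set.ofPred_forall]
  exact MeasurableSet.iInter fun i => MeasurableSet.iInter fun _ => MeasurableSet.iInter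
    fun _ => hY i (measurableSet_singleton q).compl

theorem natCast_lt_returnTime_iff {Q : Type*} (q : Q) (x : ℕ → Q) (n : ℕ) :
    (n : ℕ∞) < returnTime q x ↔ ∀ i, 1 ≤ i → i ≤ n → x i ≠ q := by
  constructor
  · intro h i h1 h2 h3
    have : returnTime q x ≤ i := iInf₂_le i ⟨h1, h3⟩
    exact absurd (h.trans_le this) (by simpa using h2)
  · intro h
    have : ((n + 1 : ℕ) : ℕ∞) ≤ returnTime q x := le_iInf₂ fun i hi => by
      by_contra hlt
      have : i < n + 1 := by exact_mod_cast not_le.1 hlt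
      exact h i hi.1 (by omega) hi.2
    exact lt_of_lt_of_le (by exact_mod_cast Nat.lt_succ_self n) this

section ReturnTime

variable {Q : Type*} [Finite Q] [MeasurableSpace Q] [DiscreteMeasurableSpace Q]
  {Ω : Type*} [MeasurableSpace Ω]

open Classical in
/-- `M.avoid q n x` is the probability that the chain started in `x` does not visit `q` in the
first `n` steps. -/
noncomputable def avoid (M : MarkovChain Q) (q : Q) : ℕ → Q → ℝ≥0∞
  | 0, _ => 1
  | n + 1, x => ∫⁻ y, (if y = q then 0 else avoid M q n y) ∂M.kernel x

open Classical in
-- This ties the recursion `avoid` to path probabilities. Each induction step unfolds one transition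
-- and absorbs it into the history, so `m` must be general.
theorem HasTransitions.lintegral_avoid {M : MarkovChain Q} {Y : ℕ → Ω → Q} {μ : Measure Ω}
    [IsProbabilityMeasure μ] (hY : M.HasTransitions Y μ) (q : Q) (n m : ℕ) :
    ∫⁻ ω, (if ∀ i, 1 ≤ i → i ≤ m → Y i ω ≠ q then M.avoid q n (Y m ω) else 0) ∂μ =
      μ {ω | ∀ i, 1 ≤ i → i ≤ m + n → Y i ω ≠ q} := by
  have hH := measurable_history hY.measurable
  induction n generalizing m with
  | zero =>
    rw [add_zero, ← lintegral_indicator_one (measurableSet_forall_ne hY.measurable q m)]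
    refine lintegral_congr fun ω => ?_
    simp only [Set.indicator_apply, Set.mem_ofPred_eq, avoid, Pi.one_apply]
    congr
  | succ n ih =>
    have hp := Measure.isProbabilityMeasure_map (μ := μ) (hH m).aemeasurable
    let l : ((i : Finset.Iic m) → (fun _ : ℕ => Q) i) → Q := fun h => h ⟨m, Finset.mem_Iic.2 le_rfl⟩
    let A : ((i : Finset.Iic m) → (fun _ : ℕ => Q) i) → Prop := fun h =>
      ∀ i : Finset.Iic m, 1 ≤ (i : ℕ) → h i ≠ q
    let v : Q → ℝ≥0∞ := fun y => if y = q then 0 else M.avoid q n y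
    have hA : ∀ ω, A (history Y m ω) ↔ ∀ i, 1 ≤ i → i ≤ m → Y i ω ≠ q := fun ω =>
      ⟨fun h i h1 h2 => h ⟨i, Finset.mem_Iic.2 h2⟩ h1,
        fun h i h1 => h i h1 (Finset.mem_Iic.1 i.2)⟩
    calc ∫⁻ ω, (if ∀ i, 1 ≤ i → i ≤ m → Y i ω ≠ q then M.avoid q (n + 1) (Y m ω) else 0) ∂μ
        = ∫⁻ h, (if A h then ∫⁻ y, v y ∂M.kernel (l h) else 0) ∂(μ.map (history Y m)) := by
          rw [lintegral_map Measurable.of_discrete (hH m)]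
          refine lintegral_congr fun ω => ?_
          simp only [hA]
          congr
      _ = ∫⁻ h, ∫⁻ y, (if A h then v y else 0) ∂M.historyKernel m h
            ∂(μ.map (history Y m)) := by
          refine lintegral_congr fun h => ?_
          split_ifs
          · rfl
          · simp
      _ = ∫⁻ p, (if A p.1 then v p.2 else 0) ∂(μ.map (history Y m) ⊗ₘ M.historyKernel m) :=
          (Measure.lintegral_compProd (f := fun p => if A p.1 then v p.2 else 0)
            Measurable.of_discrete).symm
      _ = ∫⁻ ω, (if A (history Y m ω) then v (Y (m + 1) ω) else 0) ∂μ := by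
          rw [hY.map_history_compProd,
            lintegral_map Measurable.of_discrete ((hH m).prodMk (hY.measurable _))]
      _ = ∫⁻ ω, (if ∀ i, 1 ≤ i → i ≤ m + 1 → Y i ω ≠ q then
            M.avoid q n (Y (m + 1) ω) else 0) ∂μ := by
          refine lintegral_congr fun ω => ?_
          have hiff : (∀ i, 1 ≤ i → i ≤ m + 1 → Y i ω ≠ q) ↔
              A (history Y m ω) ∧ Y (m + 1) ω ≠ q := by
            rw [hA]
            refine ⟨fun h => ⟨fun i h1 h2 => h i h1 (by omega), h _ (by omega) le_rfl⟩,
              fun h i h1 h2 => ?_⟩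
            rcases Nat.lt_or_ge i (m + 1) with h3 | h3
            · exact h.1 i h1 (by omega)
            · rw [le_antisymm h2 h3]; exact h.2
          by_cases h1 : A (history Y m ω) <;> by_cases h2 : Y (m + 1) ω = q <;>
            simp [hiff, h1, h2, v]
      _ = _ := by rw [ih (m + 1)]; simp only [add_assoc, add_comm 1 n]

/-- The expected time of the first visit to `q` at a time `n ≥ 1` of the chain started in `x`. -/
noncomputable def hittingTime (M : MarkovChain Q) (q x : Q) : ℝ≥0∞ := ∑' n, M.avoid q n x

/-- Tail-sum formula: the expectation of the return time `T` is the sum of the probabilities of `n <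
T`, and these are the values `avoid q n q`. -/
theorem expectedReturnTime_eq_hittingTime (M : MarkovChain Q) (q : Q) :
    M.expectedReturnTime q = M.hittingTime q q := by
  classical
  have hmeas := measurableSet_forall_ne (M.pathMeasure_hasTransitions q).measurable q
  have hind : ∀ n : ℕ, (fun x : ℕ → Q => if (n : ℕ∞) < returnTime q x then (1 : ℝ≥0∞) else 0) =
      Set.indicator {x : ℕ → Q | ∀ i, 1 ≤ i → i ≤ n → x i ≠ q} 1 := fun n => by
    funext x
    simp only [natCast_lt_returnTime_iff, Set.indicator_apply, Set.mem_ofPred_eq, Pi.one_apply]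
  simp only [expectedReturnTime, hittingTime, ENat.toENNReal_eq_tsum (returnTime q _)]
  rw [lintegral_tsum fun n => by
    rw [hind]; exact (measurable_one.indicator (hmeas n)).aemeasurable]
  refine tsum_congr fun n => ?_
  rw [hind, lintegral_indicator_one (hmeas n)]
  have h := (M.pathMeasure_hasTransitions q).lintegral_avoid q n 0
  rw [zero_add] at h
  rw [← h, lintegral_congr_ae (g := fun _ => M.avoid q n q)]
  · simp
  · filter_upwards [M.pathMeasure_initial q] with x hx
    rw [if_pos (by omega), hx]

open Classical in
theorem hittingTime_eq (M : MarkovChain Q) (q x : Q) :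
    M.hittingTime q x = 1 + ∫⁻ y, (if y = q then 0 else M.hittingTime q y) ∂M.kernel x := by
  have h : ∀ y, (if y = q then 0 else M.hittingTime q y) =
      ∑' n, if y = q then 0 else M.avoid q n y := fun y => by split_ifs <;> simp [hittingTime]
  simp only [h]
  rw [lintegral_tsum fun _ => (Measurable.of_discrete).aemeasurable, hittingTime,
    tsum_eq_zero_add' ENNReal.summable]
  rfl

theorem avoid_antitone (M : MarkovChain Q) (q x : Q) : Antitone fun n => M.avoid q n x := by
  classical
  refine antitone_nat_of_succ_le fun n => ?_
  induction n generalizing x with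
  | zero =>
    refine (lintegral_mono (g := fun _ => 1) fun y => ?_).trans (by simp [avoid])
    split_ifs <;> simp [avoid]
  | succ n ih =>
    refine lintegral_mono fun y => ?_
    split_ifs
    · rfl
    · exact ih y

theorem avoid_le_one (M : MarkovChain Q) (q x : Q) (n : ℕ) : M.avoid q n x ≤ 1 :=
  M.avoid_antitone q x (Nat.zero_le n)

/-- Wherever the chain stands after `n` steps, avoiding `q` for `N` more costs a factor `c`. -/
theorem avoid_add_le {M : MarkovChain Q} {q : Q} {N : ℕ} {c : ℝ≥0∞}
    (hc : ∀ x, M.avoid q N x ≤ c) (n : ℕ) (x : Q) :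
    M.avoid q (n + N) x ≤ c * M.avoid q n x := by
  classical
  induction n generalizing x with
  | zero => simpa [avoid] using hc x
  | succ n ih =>
    rw [Nat.add_right_comm]
    simp only [avoid]
    rw [← lintegral_const_mul _ Measurable.of_discrete]
    refine lintegral_mono fun y => ?_
    split_ifs
    · simp
    · exact ih y

theorem avoid_succ_lt_one {M : MarkovChain Q} {q x y : Q} {n : ℕ} (hxy : M.trans x y ≠ 0)
    (h : y = q ∨ M.avoid q n y < 1) : M.avoid q (n + 1) x < 1 := by
  classical
  have hle : ∀ z, (if z = q then 0 else M.avoid q n z) ≤ 1 := fun z => by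
    split_ifs
    · simp
    · exact M.avoid_le_one q z n
  calc M.avoid q (n + 1) x < ∫⁻ _, 1 ∂M.kernel x := by
        refine lintegral_strict_mono_of_ae_le_of_ae_lt_on (s := {y}) (by fun_prop)
          (ne_top_of_le_ne_top (b := 1) (by simp)
            ((lintegral_mono hle).trans (by simp)))
          (ae_of_all _ hle) (by rwa [kernel_singleton]) (ae_of_all _ ?_)
        rintro z rfl
        split_ifs with hz
        · simp
        · exact h.resolve_left hz
    _ = 1 := by simp

/-- Strictness propagates backwards along a path of positive probability to `q`. -/
theorem Connected.exists_avoid_lt_one {M : MarkovChain Q} (hM : M.Connected) (q x : Q) :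
    ∃ n, M.avoid q n x < 1 := by
  have key : ∀ y, y = q ∨ ∃ n, M.avoid q n y < 1 := fun y => by
    induction hM y q using Relation.ReflTransGen.head_induction_on with
    | refl => exact .inl rfl
    | head hxy _ ih =>
      rcases ih with h | ⟨n, h⟩
      · exact .inr ⟨0 + 1, avoid_succ_lt_one hxy (.inl h)⟩
      · exact .inr ⟨n + 1, avoid_succ_lt_one hxy (.inr h)⟩
  -- Only visits at times `≥ 1` count, so for `x = q` the empty path proves nothing; one step is
  -- taken first.
  obtain ⟨y, hy⟩ := (M.trans x).support_nonempty
  have hxy : M.trans x y ≠ 0 := hy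
  rcases key y with h | ⟨n, h⟩
  · exact ⟨0 + 1, avoid_succ_lt_one hxy (.inl h)⟩
  · exact ⟨n + 1, avoid_succ_lt_one hxy (.inr h)⟩

/-- As `Q` is finite, one `N` and one `c < 1` bound `avoid q N` at all states. Each partial sum `S`
of the series is finite and satisfies `S ≤ N + c * S`, hence `S ≤ N / (1 - c)`. -/
theorem Connected.hittingTime_ne_top {M : MarkovChain Q} (hM : M.Connected) (q x : Q) :
    M.hittingTime q x ≠ ∞ := by
  have := Fintype.ofFinite Q
  choose n hn using hM.exists_avoid_lt_one q
  set N := Finset.univ.sup n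
  have hN : ∀ y, M.avoid q N y < 1 := fun y =>
    (M.avoid_antitone q y (Finset.le_sup (Finset.mem_univ y))).trans_lt (hn y)
  set c : ℝ≥0∞ := Finset.univ.sup fun y => M.avoid q N y with hc
  have hc1 : c < 1 := (Finset.sup_lt_iff (by simp)).2 fun y _ => hN y
  have hcN : ∀ y, M.avoid q N y ≤ c := fun y =>
    Finset.le_sup (f := fun y => M.avoid q N y) (Finset.mem_univ y)
  have hsum : ∀ k, ∑ i ∈ Finset.range k, M.avoid q i x ≤ N / (1 - c) := fun k => by
    set S := ∑ i ∈ Finset.range k, M.avoid q i x with hS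
    have hStop : S ≠ ∞ := ENNReal.sum_ne_top.2 fun i _ =>
      ne_top_of_le_ne_top ENNReal.one_ne_top (M.avoid_le_one q x i)
    have h1 : S ≤ N + c * S := by
      calc S ≤ ∑ i ∈ Finset.range (N + k), M.avoid q i x :=
            Finset.sum_le_sum_of_subset (Finset.range_mono (by omega))
        _ = ∑ i ∈ Finset.range N, M.avoid q i x +
              ∑ i ∈ Finset.range k, M.avoid q (N + i) x := Finset.sum_range_add _ _ _
        _ ≤ ∑ i ∈ Finset.range N, 1 + ∑ i ∈ Finset.range k, c * M.avoid q i x := by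
            gcongr with i _ i _
            · exact M.avoid_le_one q x i
            · rw [add_comm]; exact avoid_add_le hcN i x
        _ = N + c * S := by simp [hS, Finset.mul_sum]
    rw [ENNReal.le_div_iff_mul_le (.inl (tsub_pos_of_lt hc1).ne') (.inl (by simp)), mul_comm,
      ENNReal.sub_mul fun _ _ => hStop, one_mul]
    exact tsub_le_iff_right.2 h1
  refine ne_top_of_le_ne_top ?_ (ENNReal.tsum_le_of_sum_range_le hsum)
  exact ENNReal.div_ne_top (by simp) (tsub_pos_of_lt hc1).ne'

end ReturnTime

end MarkovChain

/-! ### The Poisson equation and the visit-count identity -/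

namespace MarkovChain

variable {Q : Type*} [Finite Q] [MeasurableSpace Q] [DiscreteMeasurableSpace Q]

open Classical in
/-- The expected time of the first visit to `q` at a time `n ≥ 0` of the chain started in `x`. It
solves the Poisson equation of the indicator function of `q`. -/
noncomputable def potential (M : MarkovChain Q) (q x : Q) : ℝ :=
  if x = q then 0 else (M.hittingTime q x).toReal

theorem potential_nonneg (M : MarkovChain Q) (q x : Q) : 0 ≤ M.potential q x := by
  unfold potential; split_ifs <;> simp

open Classical in
-- First-step analysis read in `ℝ`. At `x = q` the potential is `0` rather than the return time,
-- which the last term corrects.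
theorem Connected.integral_potential {M : MarkovChain Q} (hM : M.Connected) (q x : Q) :
    ∫ y, M.potential q y ∂M.kernel x =
      M.potential q x - 1 + if x = q then (M.hittingTime q q).toReal else 0 := by
  have h : ∀ y, M.potential q y = (if y = q then 0 else M.hittingTime q y).toReal := fun y => by
    unfold potential; split_ifs <;> simp
  have h1 : (M.hittingTime q x).toReal = 1 + ∫ y, M.potential q y ∂M.kernel x := by
    have hne := hM.hittingTime_ne_top q x
    rw [hittingTime_eq] at hne ⊢
    simp only [h]
    rw [integral_toReal (Measurable.of_discrete).aemeasurable (ae_of_all _ fun y => ?_),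
      ENNReal.toReal_add (by simp) (ENNReal.add_ne_top.1 hne).2, ENNReal.toReal_one]
    split_ifs
    · simp
    · exact (hM.hittingTime_ne_top q y).lt_top
  unfold potential at h1 ⊢
  split_ifs with hx
  · subst hx; linarith
  · linarith

/-- The Poisson equation summed along the window: potentials telescope, and each visit to `q`
contributes one `hittingTime q q`. The identity holds pointwise for any sequence `X`. -/
theorem Connected.visits_mul_hittingTime {Ω : Type*} {M : MarkovChain Q}
    (hM : M.Connected) (s : ℕ → ℕ) (X : ℕ → Ω → Q) (q : Q) (n k : ℕ) (ω : Ω) :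
    visits s X q n k ω * (M.hittingTime q q).toReal =
      k - M.deviation (M.potential q) (fun i => X (i + 1)) (s n) k ω +
        (M.potential q (X (s n + k + 1) ω) - M.potential q (X (s n + 1) ω)) := by
  classical
  induction k with
  | zero => simp [visits, deviation]
  | succ k ih =>
    have hv : (visits s X q n (k + 1) ω : ℝ) =
        visits s X q n k ω + if X (s n + k + 1) ω = q then 1 else 0 := by
      unfold visits
      rw [Finset.sum_Icc_succ_top (by omega), ← add_assoc]
      push_cast
      rfl
    rw [hv, add_mul, ih]
    simp only [deviation, Finset.sum_range_succ, hM.integral_potential, ← add_assoc]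
    push_cast
    split_ifs <;> ring

end MarkovChain

/-! ### The limit theorem -/

theorem mainTheorem1 {Q : Type*} [Finite Q] [MeasurableSpace Q] [DiscreteMeasurableSpace Q]
    (M : MarkovChain Q) (hM : M.Connected) (s : ℕ → ℕ)
    {Ω : Type*} [MeasurableSpace Ω] (μ : Measure Ω) [IsProbabilityMeasure μ]
    (X : ℕ → Ω → Q) (hX : M.IsMarkov X μ) (q : Q) :
    ∀ᵐ ω ∂μ, Tendsto (fun n : ℕ => (visits s X q n n ω : ℝ) / n) atTop (𝓝 (M.frequency q)) := by
  obtain ⟨B, hB⟩ := (Set.finite_range (M.potential q)).bddAbove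
  have hB' : ∀ x, M.potential q x ≤ B := fun x => hB ⟨x, rfl⟩
  have hIcc : ∀ x, M.potential q x ∈ Set.Icc 0 B := fun x => ⟨M.potential_nonneg q x, hB' x⟩
  set H := (M.hittingTime q q).toReal with hH
  have hH0 : H ≠ 0 := by
    refine ENNReal.toReal_ne_zero.2 ⟨?_, hM.hittingTime_ne_top q q⟩
    rw [M.hittingTime_eq]
    simp
  have hf : M.frequency q = H⁻¹ := by
    rw [MarkovChain.frequency, M.expectedReturnTime_eq_hittingTime, ENNReal.toReal_inv]
  filter_upwards [HasSubgaussianMGF.tendsto_div_atTop_zero fun n =>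
    hX.hasTransitions.hasSubgaussianMGF_deviation hIcc (s n) n] with ω hω
  have hbd : Tendsto (fun n : ℕ => (M.potential q (X (s n + n + 1) ω) -
      M.potential q (X (s n + 1) ω)) / n) atTop (𝓝 0) := by
    refine squeeze_zero_norm (a := fun n : ℕ => B / n) (fun n => ?_)
      (tendsto_const_div_atTop_nhds_zero_nat B)
    rw [norm_div, Real.norm_natCast]
    gcongr
    rw [Real.norm_eq_abs, abs_le]
    have h1 := hIcc (X (s n + n + 1) ω)
    have h2 := hIcc (X (s n + 1) ω)
    constructor <;> linarith [h1.1, h1.2, h2.1, h2.2]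
  -- The visit-count identity with `k = n`, divided by `n * H`; the constant `1` stands for `n / n`,
  -- so the two sides are compared only for `n ≠ 0`.
  have hlim := (((tendsto_const_nhds (x := (1 : ℝ))).sub hω).add hbd).mul_const H⁻¹
  simp only [sub_zero, add_zero, one_mul] at hlim
  rw [hf]
  refine hlim.congr' ?_
  filter_upwards [eventually_ne_atTop 0] with n hn
  have hn' : (n : ℝ) ≠ 0 := by exact_mod_cast hn
  rw [eq_comm, eq_mul_inv_iff_mul_eq₀ hH0, div_mul_eq_mul_div,
    hM.visits_mul_hittingTime s X q n n ω]
  field_simp
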